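/- Setting. Let $\mathcal W(q)$ be the $q$-Weyl algebra over $\mathbb C$, generated by $e^{\pm u},e^{\pm w}$ with $e^{u}e^{w}=q\,e^{w}e^{u}$. For $r,s,f,g\in\mathbb C$ define $\mathscr L^{ab}_{ij}\in\mathcal W(q)$ ($a,b,i,j\in\{0,1\}$) by $\mathscr L^{00}_{00}=r$, $\mathscr L^{11}_{11}=s$, $\mathscr L^{10}_{10}=fe^{u}$, $\mathscr L^{01}_{01}=ge^{u}$, $\mathscr L^{10}_{01}=e^{-w}$, $\mathscr L^{01}_{10}=rs\,e^{w}+fg\,e^{2u+w}$ (where $e^{2u+w}=e^{u}e^{w}e^{u}$), and $\mathscr L^{ab}_{ij}=0$ otherwise. Let $G$ be a wiring diagram on the torus $\mathbb R^2/\mathbb Z^2$: finitely many directed closed immersed $C^1$ wires whose only (self-)intersections are finitely many transverse double points, the vertices. Let $K$ be the number of vertices, and attach to each vertex $v$ parameters $r_v,s_v,f_v,g_v\in\mathbb C$ and its own tensor factor of $\mathcal W_K(q)=\mathcal W(q)^{\otimes K}$. At a vertex, the first wire is the one such that the second wire points to its left; if the incoming states of the first and second wire are $i,j\in\{0,1\}$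 and the outgoing ones are $a,b$, the vertex has weight $\mathscr L^{ab}_{ij}(r_v,s_v,f_v,g_v)$. A fundamental domain is a parallelogram in $\mathbb R^2$ spanned from a corner by vectors $\vec A,\vec B$ that are the rows of a matrix in $SL(2,\mathbb Z)$, such that no vertex of $G$ lies on its boundary and the wires cross its sides transversally, in finitely many points that are not corners. The east and north sides are those opposite to the sides from the corner along $\vec B$ and $\vec A$, respectively. Let $m$ and $n$ be the numbers of crossings of wires with the east and the north side, and let $s_x(k)$, $s_y(k)$ be $+1$ if the $k$-th arrow on the east (resp. north) side is outgoing and $-1$ if it is incoming. For $\mathbf i\in\{0,1\}^m$, $\mathbf j\in\{0,1\}^n$ put $\|\mathbf i\|=\sum_k s_x(k)i_k$ and $\|\mathbf j\|=\sum_k s_y(k)j_k$. Cut the wires at the vertices and at the boundary of the domain, and let $T^{\mathbf a,\mathbf b}_{\mathbf i,\mathbf j}\in\mathcal W_K(q)$ be the sum, over all assignments of $0,1$ to the resulting pieces that have the values $\mathbf a,\mathbf b$ at the east and north sides and $\mathbf i,\mathbf j$ at the west and south sides, of the product of the vertex weights. For nonzero $x,y\in\mathbb C$, the monodromy matrix on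 $(\mathbb C^2)^{\otimes (m+n)}$ has the matrix elements $x^{\|\mathbf a\|}y^{\|\mathbf b\|}T^{\mathbf a,\mathbf b}_{\mathbf i,\mathbf j}$, and its trace is the transfer matrix $$T_G(x,y)=\sum_{\mathbf i,\mathbf j}T^{\mathbf i,\mathbf j}_{\mathbf i,\mathbf j}\,x^{\|\mathbf i\|}y^{\|\mathbf j\|}\in\mathcal W_K(q).$$ Proposition. (1) $T_G(x,y)$ is invariant under translation of the fundamental domain: two fundamental domains which are translates of each other have the same $T_G(x,y)$ for all nonzero $x,y\in\mathbb C$. (2) Let $S=\begin{pmatrix}a&b\\c&d\end{pmatrix}\in SL(2,\mathbb Z)$. Let $D$ be a fundamental domain spanned by $\vec A,\vec B$, and let $D'$ be a fundamental domain (with any corner) spanned by $\vec A'=a\vec A+b\vec B$ and $\vec B'=c\vec A+d\vec B$. For nonzero $x,y\in\mathbb C$ put $(x',y')=(x^ay^b,x^cy^d)$. If $$T_G(x,y)=\sum_{\mathbf i,\mathbf j}T^{\mathbf i,\mathbf j}_{\mathbf i,\mathbf j}\,x^{\|\mathbf i\|}y^{\|\mathbf j\|}$$ is the transfer matrix for $D$,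 then the transfer matrix for $D'$ at the spectral parameters $(x',y')$ is $$\sum_{\mathbf i,\mathbf j}T^{\mathbf i,\mathbf j}_{\mathbf i,\mathbf j}\,x'^{\,n_x}y'^{\,n_y},\qquad (n_x,n_y)=(\|\mathbf i\|,\|\mathbf j\|)\,S^{-1},$$ with the sum, the $T^{\mathbf i,\mathbf j}_{\mathbf i,\mathbf j}$ and the $\|\mathbf i\|,\|\mathbf j\|$ still those for $D$; and it is equal to the transfer matrix for $D$ at $(x,y)$. -/

import Mathlib

open scoped Matrix TensorProduct

/-! The `q`-Weyl algebra and the operator placed at a vertex. -/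

/-- Symbols for the generators `e^u, e^(-u), e^w, e^(-w)`. -/
inductive QWeylGen : Type
  | u
  | uInv
  | w
  | wInv

/-- The defining relations: `e^(-u)`, `e^(-w)` are inverse to `e^u`, `e^w`, and
`e^u e^w = q e^w e^u`. -/
inductive QWeylRel (q : ℂ) : FreeAlgebra ℂ QWeylGen → FreeAlgebra ℂ QWeylGen → Prop
  | u_uInv : QWeylRel q (FreeAlgebra.ι ℂ QWeylGen.u * FreeAlgebra.ι ℂ QWeylGen.uInv) 1
  | uInv_u : QWeylRel q (FreeAlgebra.ι ℂ QWeylGen.uInv * FreeAlgebra.ι ℂ QWeylGen.u) 1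
  | w_wInv : QWeylRel q (FreeAlgebra.ι ℂ QWeylGen.w * FreeAlgebra.ι ℂ QWeylGen.wInv) 1
  | wInv_w : QWeylRel q (FreeAlgebra.ι ℂ QWeylGen.wInv * FreeAlgebra.ι ℂ QWeylGen.w) 1
  | u_w : QWeylRel q (FreeAlgebra.ι ℂ QWeylGen.u * FreeAlgebra.ι ℂ QWeylGen.w)
      (q • (FreeAlgebra.ι ℂ QWeylGen.w * FreeAlgebra.ι ℂ QWeylGen.u))

/-- The `q`-Weyl algebra over `ℂ`. -/
abbrev QWeyl (q : ℂ) : Type := RingQuot (QWeylRel q)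

namespace QWeyl

/-- The image of a generator in the `q`-Weyl algebra. -/
noncomputable def gen (q : ℂ) (a : QWeylGen) : QWeyl q :=
  RingQuot.mkAlgHom ℂ (QWeylRel q) (FreeAlgebra.ι ℂ a)

/-- The matrix element with outgoing states `a, b` and incoming states `i, j`; `a, i` belong to
the first line and `b, j` to the second one. Since `[u, w] = ħ` and `q = e^ħ`, one has
`e^(2u + w) = e^u e^w e^u`. -/
noncomputable def weight (q r s f g : ℂ) (a b i j : Fin 2) : QWeyl q :=
  match a, b, i, j with
  | 0, 0, 0, 0 => algebraMap ℂ (QWeyl q) r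
  | 1, 1, 1, 1 => algebraMap ℂ (QWeyl q) s
  | 1, 0, 1, 0 => f • gen q .u
  | 0, 1, 0, 1 => g • gen q .u
  | 1, 0, 0, 1 => gen q .wInv
  | 0, 1, 1, 0 => (r * s) • gen q .w + (f * g) • (gen q .u * gen q .w * gen q .u)
  | _, _, _, _ => 0

end QWeyl

/-! Wiring diagrams on the torus `ℝ² / ℤ²`. -/

/-- The integer vector `l`, seen in `ℝ²`. -/
def latticeVec (l : Fin 2 → ℤ) : Fin 2 → ℝ := fun e => (l e : ℝ)

/-- The determinant of two plane vectors. It is positive when `w` points to the left of `v`. -/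
def planeDet (v w : Fin 2 → ℝ) : ℝ := v 0 * w 1 - v 1 * w 0

/-- A wiring diagram on the torus `ℝ² / ℤ²`: finitely many directed closed wires, which are
immersed closed curves of class `C¹`, all of whose (self-)intersections are transverse double
points. Each wire is given by a lift `ℝ → ℝ²`; it is directed by increasing parameter and it is
traversed once when the parameter runs through `[0, 1)`. -/
structure WiringDiagram where
  /-- the number of wires -/
  numWires : ℕ
  /-- the lifts of the wires to the plane -/
  curve : Fin numWires → ℝ → Fin 2 → ℝ
  contDiff : ∀ k, ContDiff ℝ 1 (curve k)
  immersed : ∀ k t, deriv (curve k) t ≠ 0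
  closed : ∀ k, ∃ l : Fin 2 → ℤ, ∀ t, curve k (t + 1) = curve k t + latticeVec l
  /-- two distinct passages through the same point of the torus are transverse -/
  transverse : ∀ p p' : Fin numWires × ℝ, p.2 ∈ Set.Ico 0 1 → p'.2 ∈ Set.Ico 0 1 → p ≠ p' →
    (∃ l : Fin 2 → ℤ, curve p.1 p.2 = curve p'.1 p'.2 + latticeVec l) →
    planeDet (deriv (curve p.1) p.2) (deriv (curve p'.1) p'.2) ≠ 0
  /-- no point of the torus is passed three times -/
  double : ∀ p p' p'' : Fin numWires × ℝ,
    p.2 ∈ Set.Ico 0 1 → p'.2 ∈ Set.Ico 0 1 → p''.2 ∈ Set.Ico 0 1 →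
    (∃ l : Fin 2 → ℤ, curve p.1 p.2 = curve p'.1 p'.2 + latticeVec l) →
    (∃ l : Fin 2 → ℤ, curve p'.1 p'.2 = curve p''.1 p''.2 + latticeVec l) →
    p = p' ∨ p' = p'' ∨ p = p''
  /-- there are finitely many crossings -/
  finite_crossings : {p : (Fin numWires × ℝ) × (Fin numWires × ℝ) |
    p.1.2 ∈ Set.Ico 0 1 ∧ p.2.2 ∈ Set.Ico 0 1 ∧ p.1 ≠ p.2 ∧
      ∃ l : Fin 2 → ℤ, curve p.1.1 p.1.2 = curve p.2.1 p.2.2 + latticeVec l}.Finite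

namespace WiringDiagram

/-- A place on the wires: the number of a wire and a parameter. In all the sets of places below,
the parameter is in `[0, 1)`, so that every point of a wire is counted once. -/
abbrev Place (G : WiringDiagram) : Type := Fin G.numWires × ℝ

/-- The point of the plane at a place. -/
def point (G : WiringDiagram) (p : G.Place) : Fin 2 → ℝ := G.curve p.1 p.2

/-- The tangent vector at a place. -/
noncomputable def velocity (G : WiringDiagram) (p : G.Place) : Fin 2 → ℝ :=
  deriv (G.curve p.1) p.2

/-- A vertex is a crossing, recorded as the pair of the two passages of wires through it in the
order in which the second passage points to the left of the first one (as when the first is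
drawn from west to east and the second from south to north). -/
def IsVertex (G : WiringDiagram) (p : G.Place × G.Place) : Prop :=
  p.1.2 ∈ Set.Ico 0 1 ∧ p.2.2 ∈ Set.Ico 0 1 ∧
    (∃ l : Fin 2 → ℤ, G.point p.1 = G.point p.2 + latticeVec l) ∧
    0 < planeDet (G.velocity p.1) (G.velocity p.2)

/-- The type of vertices. -/
def Vertex (G : WiringDiagram) : Type := {p : G.Place × G.Place // G.IsVertex p}

/-- The first passage at a vertex. -/
def Vertex.first {G : WiringDiagram} (v : G.Vertex) : G.Place := v.1.1

/-- The second passage at a vertex. -/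
def Vertex.second {G : WiringDiagram} (v : G.Vertex) : G.Place := v.1.2

/-- All the passages of wires through vertices. -/
def passages (G : WiringDiagram) : Set G.Place :=
  Set.range Vertex.first ∪ Set.range Vertex.second

instance finite_vertex (G : WiringDiagram) : Finite G.Vertex := by
  refine (G.finite_crossings.subset ?_).to_subtype
  rintro p ⟨h1, h2, h3, h4⟩
  refine ⟨h1, h2, ?_, h3⟩
  intro h
  rw [h] at h4
  simp [planeDet, mul_comm] at h4

/-- The tensor product of copies of the `q`-Weyl algebra, one for each vertex. -/
abbrev WeylTensor (G : WiringDiagram) (q : ℂ) : Type := ⨂[ℂ] _ : G.Vertex, QWeyl q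

/-- `c'` is the next place of `C` after `c` along a wire: going from `c` in the direction
of the wire, the first parameter value (taken modulo 1) that belongs to `C` is that of `c'`. If
`c` is the only place of `C` on its wire, then the next one is `c` itself. -/
def Next (G : WiringDiagram) (C : Set G.Place) (c c' : G.Place) : Prop :=
  c.1 = c'.1 ∧ ∃ b : ℝ, c.2 < b ∧ Int.fract b = c'.2 ∧
    ∀ u ∈ Set.Ioo c.2 b, (c.1, Int.fract u) ∉ C

/-- A labelling by `0, 1` of the pieces into which the wires are cut by a set `C` of places.
A piece is either an arc from a place `c` in `C` to the next one, whose label is both the label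
directly after `c` and the label directly before the next place, or a whole wire without
any place of `C`. -/
structure Labelling (G : WiringDiagram) (C : Set G.Place) where
  /-- the label of the arc that ends at the given place -/
  before : C → Fin 2
  /-- the label of the arc that starts at the given place -/
  after : C → Fin 2
  /-- the labels of the wires that are not cut -/
  loop : {k : Fin G.numWires // ∀ t, (k, t) ∉ C} → Fin 2
  arc : ∀ c c' : C, G.Next C c c' → after c = before c'

instance finite_labelling (G : WiringDiagram) (C : Set G.Place) [Finite C] :
    Finite (G.Labelling C) := by
  refine Finite.of_injective
    (fun m : G.Labelling C => (m.before, m.after, m.loop)) ?_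
  rintro ⟨a, b, c, _⟩ ⟨a', b', c', _⟩ h
  simp only [Prod.mk.injEq] at h
  obtain ⟨rfl, rfl, rfl⟩ := h
  rfl

end WiringDiagram

/-! Fundamental domains. -/

/-- A parallelogram with a corner in the plane, spanned by the rows `A`, `B` of a matrix in
`SL(2, ℤ)`. Its sides from the corner are parallel to `A` (south) and to `B` (west); the
opposite ones are the north and the east side. -/
structure Parallelogram where
  corner : Fin 2 → ℝ
  basis : Matrix.SpecialLinearGroup (Fin 2) ℤ

namespace Parallelogram

/-- The coordinates of a vector with respect to `A` and `B`. -/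
noncomputable def linCoord (P : Parallelogram) (v : Fin 2 → ℝ) : Fin 2 → ℝ :=
  v ᵥ* ((P.basis⁻¹ : Matrix.SpecialLinearGroup (Fin 2) ℤ) : Matrix (Fin 2) (Fin 2) ℤ).map
    (Int.cast : ℤ → ℝ)

/-- The coordinates `(s, t)` of the point `corner + s A + t B`. A point of the torus is on the
image of the east side (which is also that of the west side) when `s` is an integer, and on the
image of the north side (which is also that of the south side) when `t` is an integer. -/
noncomputable def coord (P : Parallelogram) (z : Fin 2 → ℝ) : Fin 2 → ℝ :=
  P.linCoord (z - P.corner)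

/-- The coordinates are what they are said to be. -/
theorem coord_spec (P : Parallelogram) (s t : ℝ) :
    P.coord (P.corner + s • latticeVec (P.basis 0) + t • latticeVec (P.basis 1)) = ![s, t] := by
  have h := P.basis.det_coe
  rw [Matrix.det_fin_two] at h
  have h' : ((P.basis 0 0 : ℤ) : ℝ) * (P.basis 1 1 : ℤ) - (P.basis 0 1 : ℤ) * (P.basis 1 0 : ℤ)
      = 1 := by exact_mod_cast h
  ext e
  fin_cases e
  · simp [coord, linCoord, latticeVec, Matrix.vecMul, dotProduct, Fin.sum_univ_two,
      Matrix.SpecialLinearGroup.coe_inv, Matrix.adjugate_fin_two]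
    linear_combination s * h'
  · simp [coord, linCoord, latticeVec, Matrix.vecMul, dotProduct, Fin.sum_univ_two,
      Matrix.SpecialLinearGroup.coe_inv, Matrix.adjugate_fin_two]
    linear_combination t * h'

end Parallelogram

namespace WiringDiagram

/-- The places where a wire meets the east side (direction `0`) or the north side
(direction `1`) of a parallelogram, on the torus. -/
def sidePlaces (G : WiringDiagram) (P : Parallelogram) (e : Fin 2) : Set G.Place :=
  {p | p.2 ∈ Set.Ico 0 1 ∧ ∃ n : ℤ, P.coord (G.point p) e = n}

/-- A fundamental domain of the torus in good position with respect to the diagram: no vertex is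
on its boundary, the wires cross its sides transversally, in finitely many points which are not
corners. -/
structure FundamentalDomain (G : WiringDiagram) extends Parallelogram where
  vertex_notMem : ∀ p ∈ G.passages, ∀ e, p ∉ G.sidePlaces toParallelogram e
  cross : ∀ e, ∀ p ∈ G.sidePlaces toParallelogram e,
    toParallelogram.linCoord (G.velocity p) e ≠ 0
  corner_notMem : Disjoint (G.sidePlaces toParallelogram 0) (G.sidePlaces toParallelogram 1)
  finite_side : ∀ e, (G.sidePlaces toParallelogram e).Finite

namespace FundamentalDomain

variable {G : WiringDiagram}

/-- The arrows at the east boundary. -/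
abbrev East (D : G.FundamentalDomain) : Type := G.sidePlaces D.toParallelogram 0

/-- The arrows at the north boundary. -/
abbrev North (D : G.FundamentalDomain) : Type := G.sidePlaces D.toParallelogram 1

noncomputable instance fintypeEast (D : G.FundamentalDomain) : Fintype D.East :=
  (D.finite_side 0).fintype

noncomputable instance fintypeNorth (D : G.FundamentalDomain) : Fintype D.North :=
  (D.finite_side 1).fintype

/-- Whether the arrow at a place of the east (`e = 0`) or north (`e = 1`) boundary is outgoing;
otherwise it is incoming. -/
def Outgoing (D : G.FundamentalDomain) (e : Fin 2) (p : G.Place) : Prop :=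
  0 < D.toParallelogram.linCoord (G.velocity p) e

open Classical in
/-- The sign of an arrow: `1` when it is outgoing, `-1` when it is incoming. -/
noncomputable def sgn (D : G.FundamentalDomain) (e : Fin 2) (p : G.Place) : ℤ :=
  if D.Outgoing e p then 1 else -1

/-- The indices of the standard basis `v_i ⊗ v_j` of the auxiliary space: one tensor factor for
each arrow at the east boundary and for each arrow at the north boundary. -/
abbrev BoundaryState (D : G.FundamentalDomain) : Type := (D.East → Fin 2) × (D.North → Fin 2)

/-- The pair of signed sums `(‖i‖, ‖j‖)`. -/
noncomputable def signedSum (D : G.FundamentalDomain) (m : D.BoundaryState) : Fin 2 → ℤ :=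
  ![∑ c : D.East, D.sgn 0 c * ((m.1 c : ℕ) : ℤ), ∑ c : D.North, D.sgn 1 c * ((m.2 c : ℕ) : ℤ)]

/-- The places where the wires are cut: at the vertices and at the boundary. -/
def cuts (D : G.FundamentalDomain) : Set G.Place :=
  G.passages ∪ (G.sidePlaces D.toParallelogram 0 ∪ G.sidePlaces D.toParallelogram 1)

instance finite_cuts (D : G.FundamentalDomain) : Finite D.cuts :=
  (((Set.finite_range _).union (Set.finite_range _)).union
    ((D.finite_side 0).union (D.finite_side 1))).to_subtype

noncomputable instance fintypeLabelling (D : G.FundamentalDomain) :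
    Fintype (G.Labelling D.cuts) := Fintype.ofFinite _

theorem first_mem_cuts (D : G.FundamentalDomain) (v : G.Vertex) : v.first ∈ D.cuts :=
  Or.inl (Or.inl ⟨v, rfl⟩)

theorem second_mem_cuts (D : G.FundamentalDomain) (v : G.Vertex) : v.second ∈ D.cuts :=
  Or.inl (Or.inr ⟨v, rfl⟩)

theorem east_mem_cuts (D : G.FundamentalDomain) (c : D.East) : (c : G.Place) ∈ D.cuts :=
  Or.inr (Or.inl c.2)

theorem north_mem_cuts (D : G.FundamentalDomain) (c : D.North) : (c : G.Place) ∈ D.cuts :=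
  Or.inr (Or.inr c.2)

open Classical in
/-- The label at the east or north end of the domain, at a place of the boundary. An outgoing
wire reaches that end directly before the place, an incoming wire leaves it directly after. -/
noncomputable def farLabel (D : G.FundamentalDomain) (m : G.Labelling D.cuts) (e : Fin 2)
    (c : D.cuts) : Fin 2 :=
  if D.Outgoing e c then m.before c else m.after c

open Classical in
/-- The label at the opposite (west or south) end of the domain, at a place of the boundary. -/
noncomputable def nearLabel (D : G.FundamentalDomain) (m : G.Labelling D.cuts) (e : Fin 2)
    (c : D.cuts) : Fin 2 :=
  if D.Outgoing e c then m.after c else m.before c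

/-- The labels at the east and north boundary are given by `a`, and those at the west and south
boundary by `i`. -/
def HasBoundary (D : G.FundamentalDomain) (m : G.Labelling D.cuts) (a i : D.BoundaryState) :
    Prop :=
  (∀ c : D.East, D.farLabel m 0 ⟨c, D.east_mem_cuts c⟩ = a.1 c ∧
    D.nearLabel m 0 ⟨c, D.east_mem_cuts c⟩ = i.1 c) ∧
  (∀ c : D.North, D.farLabel m 1 ⟨c, D.north_mem_cuts c⟩ = a.2 c ∧
    D.nearLabel m 1 ⟨c, D.north_mem_cuts c⟩ = i.2 c)

/-- The product of the weights of all vertices, each in its own tensor factor. -/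
noncomputable def vertexProduct (D : G.FundamentalDomain) (q : ℂ) (r s f g : G.Vertex → ℂ)
    (m : G.Labelling D.cuts) : G.WeylTensor q :=
  PiTensorProduct.tprod ℂ fun v : G.Vertex =>
    QWeyl.weight q (r v) (s v) (f v) (g v)
      (m.after ⟨v.first, D.first_mem_cuts v⟩) (m.after ⟨v.second, D.second_mem_cuts v⟩)
      (m.before ⟨v.first, D.first_mem_cuts v⟩) (m.before ⟨v.second, D.second_mem_cuts v⟩)

open Classical in
/-- The element `T^{a}_{i}`: the sum over all the states of the inner edges with boundary states
`a` (east and north) and `i` (west and south). -/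
noncomputable def element (D : G.FundamentalDomain) (q : ℂ) (r s f g : G.Vertex → ℂ)
    (a i : D.BoundaryState) : G.WeylTensor q :=
  ∑ m : G.Labelling D.cuts with D.HasBoundary m a i, D.vertexProduct q r s f g m

/-- The monodromy matrix, in the standard basis of the auxiliary space. -/
noncomputable def monodromy (D : G.FundamentalDomain) (q : ℂ) (r s f g : G.Vertex → ℂ)
    (x y : ℂˣ) : Matrix D.BoundaryState D.BoundaryState (G.WeylTensor q) :=
  fun a i => ((x ^ D.signedSum a 0 * y ^ D.signedSum a 1 : ℂˣ) : ℂ) • D.element q r s f g a i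

/-- The transfer matrix: the trace of the monodromy matrix over the auxiliary space. -/
noncomputable def transfer (D : G.FundamentalDomain) (q : ℂ) (r s f g : G.Vertex → ℂ)
    (x y : ℂˣ) : G.WeylTensor q :=
  (D.monodromy q r s f g x y).trace

end FundamentalDomain

end WiringDiagram

/-! The trace identifies the labels at opposite sides, so the sum over boundary and inner labels
becomes a sum over labellings of the wires on the torus that change only at vertices (`State`,
`transfer_eq_sum_state`). These states and their products of vertex weights know nothing of the
fundamental domain, which enters only through the exponents of the spectral parameters.

All six nonzero weights conserve the number of labels 1 (`QWeyl.weight_eq_zero`), so in every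
contributing state the pieces labelled 1 form a closed cycle on the torus. The signed sums are the
intersection numbers of this cycle with the sides, and they are the coordinates of its homology
class in the basis of the domain (`sum_side_eq`). These coordinates do not depend on the corner, and
a change of basis by `S` multiplies them by the inverse of `S`, which the substitution of the
spectral parameters compensates. Hence the transfer matrices agree state by state.

The intersection number is computed by elementary means: along a wire, the label times the integer
part of a coordinate is a step function, whose increment over one period is the sum of its jumps
(`IsStep.sub_eq_sum`). The jumps at the sides give the signed sum; the jumps at the vertices and the
increments over the periods combine to a coordinate of `State.homology`, a vector defined without
the domain. -/

open Filter Topology Set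

/-! ### Step functions on the real line -/

/-- `L` and `R` are the left and right limits of a function which is locally constant away from a
discrete set. -/
def IsStep {α : Type*} (L R : ℝ → α) : Prop :=
  ∀ t, (∀ᶠ u in 𝓝[>] t, L u = R t ∧ R u = R t) ∧ (∀ᶠ u in 𝓝[<] t, L u = L t ∧ R u = L t)

theorem IsStep.comp₂ {α β γ : Type*} {L R : ℝ → α} {L' R' : ℝ → β} (h : IsStep L R)
    (h' : IsStep L' R') (f : α → β → γ) :
    IsStep (fun t => f (L t) (L' t)) (fun t => f (R t) (R' t)) := by
  intro t
  refine ⟨?_, ?_⟩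
  · filter_upwards [(h t).1, (h' t).1] with u hu hu'
    simp [hu.1, hu.2, hu'.1, hu'.2]
  · filter_upwards [(h t).2, (h' t).2] with u hu hu'
    simp [hu.1, hu.2, hu'.1, hu'.2]

/-- The increment of a step function is the sum of its jumps. -/
theorem IsStep.sub_eq_sum {L R : ℝ → ℤ} (h : IsStep L R) {a b : ℝ} (hab : a ≤ b) (J : Finset ℝ)
    (hJ : ∀ t ∈ Ico a b, t ∉ J → L t = R t) (hJ' : ∀ t ∈ J, t ∈ Ico a b) :
    L b - L a = ∑ t ∈ J, (R t - L t) := by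
  -- Removing the jumps before `t` leaves a locally constant function. The inequality `j < t` is
  -- strict because `L t` is the left limit and does not yet contain a jump at `t`.
  set F : ℝ → ℤ := fun t => L t - ∑ j ∈ J with j < t, (R j - L j) with hF
  have hright : ∀ t ∈ Ico a b, ∀ᶠ u in 𝓝[>] t, F u = F t := by
    intro t ht
    have h1 : ∀ᶠ u in 𝓝[>] t, ∀ j ∈ J, (j < u ↔ j ≤ t) := by
      rw [Filter.eventually_all_finset]
      intro j _
      rcases le_or_gt j t with hj | hj
      · filter_upwards [self_mem_nhdsWithin] with u hu
        exact ⟨fun _ => hj, fun _ => lt_of_le_of_lt hj hu⟩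
      · filter_upwards [mem_nhdsWithin_of_mem_nhds (Iio_mem_nhds hj)] with u hu
        exact ⟨fun h => absurd (lt_trans h hu) (lt_irrefl _), fun h => absurd h (not_le.2 hj)⟩
    filter_upwards [h1, (h t).1] with u hu hu'
    simp only [hF]
    rw [hu'.1, Finset.filter_congr hu]
    by_cases htJ : t ∈ J
    · have : J.filter (· ≤ t) = insert t (J.filter (· < t)) := by
        ext j
        simp only [Finset.mem_filter, Finset.mem_insert, le_iff_lt_or_eq]
        constructor
        · rintro ⟨h1, h2 | h2⟩
          · exact Or.inr ⟨h1, h2⟩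
          · exact Or.inl h2
        · rintro (rfl | ⟨h1, h2⟩)
          · exact ⟨htJ, Or.inr rfl⟩
          · exact ⟨h1, Or.inl h2⟩
      rw [this, Finset.sum_insert (by simp)]
      ring
    · have : J.filter (· ≤ t) = J.filter (· < t) := by
        refine Finset.filter_congr fun j hj => ⟨fun h => lt_of_le_of_ne h ?_, le_of_lt⟩
        rintro rfl
        exact htJ hj
      rw [this, hJ t ht htJ]
  have hleft : ∀ t, ∀ᶠ u in 𝓝[<] t, F u = F t := by
    intro t
    have h1 : ∀ᶠ u in 𝓝[<] t, ∀ j ∈ J, (j < u ↔ j < t) := by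
      rw [Filter.eventually_all_finset]
      intro j _
      rcases lt_or_ge j t with hj | hj
      · filter_upwards [mem_nhdsWithin_of_mem_nhds (Ioi_mem_nhds hj)] with u hu
        exact ⟨fun _ => hj, fun _ => hu⟩
      · filter_upwards [self_mem_nhdsWithin] with u hu
        exact ⟨fun h => lt_trans h hu, fun h => absurd h (not_lt.2 hj)⟩
    filter_upwards [h1, (h t).2] with u hu hu'
    simp only [hF]
    rw [hu'.1, Finset.filter_congr hu]
  have hcont : ContinuousOn F (Icc a b) := by
    intro t ht
    have key : ∀ᶠ u in 𝓝 t, u ∈ Icc a b → F u = F t := by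
      have h2 := hleft t
      have h3 : ∀ᶠ u in 𝓝[>] t, u ∈ Icc a b → F u = F t := by
        -- A jump at `b` itself does no harm: continuity is only needed within `Icc a b`, which has
        -- no points to the right of `b`.
        rcases lt_or_ge t b with hb | hb
        · filter_upwards [hright t ⟨ht.1, hb⟩] with u hu _ using hu
        · filter_upwards [self_mem_nhdsWithin] with u hu hu'
          exact absurd (lt_of_le_of_lt hb hu) (not_lt.2 hu'.2)
      rw [eventually_nhdsWithin_iff] at h2 h3
      filter_upwards [h2, h3] with u h2 h3 hu
      rcases lt_trichotomy u t with h | h | h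
      · exact h2 h
      · rw [h]
      · exact h3 h hu
    refine (continuousWithinAt_const (b := F t)).congr_of_eventuallyEq ?_ rfl
    exact eventually_nhdsWithin_iff.2 key
  have := isPreconnected_Icc.constant hcont (left_mem_Icc.2 hab) (right_mem_Icc.2 hab)
  simp only [hF] at this
  have ha : J.filter (· < a) = ∅ :=
    Finset.filter_eq_empty_iff.2 fun j hj => not_lt.2 (hJ' j hj).1
  have hb : J.filter (· < b) = J := Finset.filter_eq_self.2 fun j hj => (hJ' j hj).2
  rw [ha, hb, Finset.sum_empty] at this
  linarith

/-- A step function without jumps inside an interval is constant there. -/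
theorem IsStep.eq_of_no_jump {n : ℕ} {L R : ℝ → Fin n} (h : IsStep L R) {a b : ℝ} (hab : a < b)
    (hJ : ∀ t ∈ Ioo a b, L t = R t) : R a = L b := by
  -- Starting from `c` slightly after `a`, where `L c = R a`, skips a possible jump at `a`.
  obtain ⟨c, hc, hca, hcb⟩ := ((h a).1.and (Ioo_mem_nhdsGT hab)).exists
  have := (h.comp₂ h fun x _ => ((x : ℕ) : ℤ)).sub_eq_sum hcb.le ∅
    (fun t ht _ => by rw [hJ t ⟨hca.trans_le ht.1, ht.2⟩]) (by simp)
  rw [Finset.sum_empty, sub_eq_zero] at this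
  rw [← hc.1]
  exact (Fin.ext (by exact_mod_cast this)).symm

/-! ### States on the whole wires and labellings of the pieces -/

namespace WiringDiagram

variable {G : WiringDiagram}

/-- Labels directly before and after every place of the wires, which are allowed to jump only at
the places of `C`. -/
@[ext]
structure State (G : WiringDiagram) (C : Set G.Place) where
  before : Fin G.numWires → ℝ → Fin 2
  after : Fin G.numWires → ℝ → Fin 2
  before_periodic : ∀ k, Function.Periodic (before k) 1
  after_periodic : ∀ k, Function.Periodic (after k) 1
  step : ∀ k, IsStep (before k) (after k)
  eq_of_notMem : ∀ k t, (k, Int.fract t) ∉ C → before k t = after k t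

theorem State.before_fract {C : Set G.Place} (σ : G.State C) (k : Fin G.numWires) (t : ℝ) :
    σ.before k (Int.fract t) = σ.before k t := by
  rw [Int.fract]; simpa using (σ.before_periodic k).sub_int_mul_eq ⌊t⌋ (x := t)

theorem State.after_fract {C : Set G.Place} (σ : G.State C) (k : Fin G.numWires) (t : ℝ) :
    σ.after k (Int.fract t) = σ.after k t := by
  rw [Int.fract]; simpa using (σ.after_periodic k).sub_int_mul_eq ⌊t⌋ (x := t)

/-- The parameter `u` is that of the last place of `C` before `t`. -/
def IsPred (C : Set G.Place) (k : Fin G.numWires) (t u : ℝ) : Prop :=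
  u < t ∧ (k, Int.fract u) ∈ C ∧ ∀ w ∈ Ioo u t, (k, Int.fract w) ∉ C

theorem IsPred.unique {C : Set G.Place} {k : Fin G.numWires} {t u u' : ℝ} (h : IsPred C k t u)
    (h' : IsPred C k t u') : u = u' := by
  rcases lt_trichotomy u u' with hlt | heq | hlt
  · exact absurd h'.2.1 (h.2.2 _ ⟨hlt, h'.1⟩)
  · exact heq
  · exact absurd h.2.1 (h'.2.2 _ ⟨hlt, h.1⟩)

theorem finite_cut_params {C : Set G.Place} (hC : C.Finite) (k : Fin G.numWires) (a : ℝ) :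
    {u | u ∈ Ico a (a + 1) ∧ (k, Int.fract u) ∈ C}.Finite := by
  refine Set.Finite.of_finite_image (f := fun u => ((k, Int.fract u) : G.Place))
    (hC.subset ?_) ?_
  · rintro _ ⟨u, hu, rfl⟩
    exact hu.2
  · intro u hu v hv huv
    simp only [Prod.mk.injEq, true_and] at huv
    obtain ⟨z, hz⟩ := Int.fract_eq_fract.1 huv
    have h1 := hu.1.1; have h2 := hu.1.2; have h3 := hv.1.1; have h4 := hv.1.2
    have h5 : (z : ℝ) < 1 := by linarith
    have h6 : (-1 : ℝ) < z := by linarith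
    have : z = 0 := by
      have h5' : z < 1 := by exact_mod_cast h5
      have h6' : -1 < z := by exact_mod_cast h6
      omega
    rw [this] at hz
    simpa [sub_eq_zero] using hz

theorem eventually_notMem {C : Set G.Place} (hC : C.Finite) (k : Fin G.numWires) (t : ℝ) :
    ∃ a b, a < t ∧ t < b ∧ ∀ u ∈ Ioo a b, u ≠ t → (k, Int.fract u) ∉ C := by
  have h1 := (finite_cut_params hC k (t - 1 / 2)).sdiff (t := {t})
  have h2 := h1.isClosed.isOpen_compl.mem_nhds (x := t) (by simp)
  obtain ⟨a, b, ht, hab⟩ := mem_nhds_iff_exists_Ioo_subset.1 (inter_mem h2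
    (Ico_mem_nhds (show t - 1 / 2 < t by linarith) (show t < t - 1 / 2 + 1 by linarith)))
  exact ⟨a, b, ht.1, ht.2, fun u hu hut hmem => (hab hu).1 ⟨⟨(hab hu).2, hmem⟩, hut⟩⟩

theorem exists_isPred {C : Set G.Place} (hC : C.Finite) {k : Fin G.numWires} {c : ℝ}
    (hc : (k, Int.fract c) ∈ C) (t : ℝ) : ∃ u, IsPred C k t u := by
  have hne : {u | u ∈ Ico (t - 1) (t - 1 + 1) ∧ (k, Int.fract u) ∈ C}.Nonempty := by
    -- The window is one full period ending just before `t`, so it contains a translate of every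
    -- place of the wire; if `t` is the only cut, its predecessor is `t - 1`.
    refine ⟨toIcoMod one_pos (t - 1) c, toIcoMod_mem_Ico _ _ _, ?_⟩
    change (k, Int.fract (c - toIcoDiv one_pos (t - 1) c • (1 : ℝ))) ∈ C
    rwa [zsmul_one, Int.fract_sub_intCast]
  obtain ⟨u, hu, hmax⟩ := Set.exists_max_image _ id (finite_cut_params hC k (t - 1)) hne
  refine ⟨u, by linarith [hu.1.2], hu.2, fun w hw hmem => ?_⟩
  have := hmax w ⟨⟨by linarith [hw.1, hu.1.1], by linarith [hw.2]⟩, hmem⟩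
  exact absurd hw.1 (not_lt.2 this)

/-- Either there is a last place of `C` before any given one, or the wire is not cut. -/
theorem exists_isPred_or {C : Set G.Place} (hC : C.Finite) (hI : ∀ p ∈ C, p.2 ∈ Ico (0 : ℝ) 1)
    (k : Fin G.numWires) : (∀ t, ∃ u, IsPred C k t u) ∨ ∀ t, (k, t) ∉ C := by
  by_cases hk : ∀ t, (k, t) ∉ C
  · exact Or.inr hk
  · push Not at hk
    obtain ⟨t, ht⟩ := hk
    refine Or.inl (exists_isPred hC (c := t) ?_)
    rwa [Int.fract_eq_self.2 (hI _ ht)]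

/-- The labelling of the pieces given by a state. -/
def State.toLabelling {C : Set G.Place} (σ : G.State C) : G.Labelling C where
  before c := σ.before c.1.1 c.1.2
  after c := σ.after c.1.1 c.1.2
  loop k := σ.before k 0
  arc := by
    rintro ⟨⟨k, t⟩, hc⟩ ⟨⟨k', t'⟩, hc'⟩ ⟨hk, b, hb, hbt, hcut⟩
    simp only at hk hb hbt hcut ⊢
    subst hk hbt
    rw [σ.before_fract]
    exact (σ.step k).eq_of_no_jump hb fun u hu => σ.eq_of_notMem k u (hcut u hu)

/-- The label before any parameter is the one after the last cut, or the loop label if there is no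
cut on the wire; away from the cuts the label after a parameter is the same. -/
theorem State.toLabelling_injective {C : Set G.Place} (hC : C.Finite)
    (hI : ∀ p ∈ C, p.2 ∈ Ico (0 : ℝ) 1) :
    Function.Injective (State.toLabelling : G.State C → G.Labelling C) := by
  intro σ τ h
  have ha : ∀ (k) (t : ℝ), (k, t) ∈ C → σ.after k t = τ.after k t := fun k t ht =>
    congrFun (congrArg Labelling.after h) ⟨(k, t), ht⟩
  have hl : ∀ k (hk : ∀ t, (k, t) ∉ C), σ.before k 0 = τ.before k 0 := fun k hk =>
    congrFun (congrArg Labelling.loop h) ⟨k, hk⟩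
  have hbefore : ∀ k t, σ.before k t = τ.before k t := by
    intro k t
    rcases exists_isPred_or hC hI k with hk | hk
    · obtain ⟨u, hut, hu, hno⟩ := hk t
      rw [← (σ.step k).eq_of_no_jump hut fun w hw => σ.eq_of_notMem k w (hno w hw),
        ← (τ.step k).eq_of_no_jump hut fun w hw => τ.eq_of_notMem k w (hno w hw),
        ← σ.after_fract, ← τ.after_fract, ha _ _ hu]
    · have key : ∀ ρ : G.State C, ρ.before k t = ρ.before k 0 := by
        intro ρ
        have h0 : ∀ u, ρ.before k u = ρ.after k u := fun u => ρ.eq_of_notMem k u (hk _)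
        rcases lt_trichotomy t 0 with ht | ht | ht
        · rw [h0, (ρ.step k).eq_of_no_jump ht fun u _ => h0 u]
        · rw [ht]
        · rw [h0 0, (ρ.step k).eq_of_no_jump ht fun u _ => h0 u]
      rw [key σ, key τ, hl k hk]
  refine State.ext (funext fun k => funext (hbefore k)) (funext fun k => funext fun t => ?_)
  by_cases ht : (k, Int.fract t) ∈ C
  · rw [← σ.after_fract, ← τ.after_fract, ha _ _ ht]
  · rw [← σ.eq_of_notMem k t ht, ← τ.eq_of_notMem k t ht, hbefore]

/-- The value before `t` of a labelling. -/
theorem Labelling.exists_value {C : Set G.Place} (m : G.Labelling C)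
    (k : Fin G.numWires) (t : ℝ) : ∃ a : Fin 2,
    (∀ u (hu : IsPred C k t u), a = m.after ⟨(k, Int.fract u), hu.2.1⟩) ∧
    (∀ hk : ∀ t, (k, t) ∉ C, a = m.loop ⟨k, hk⟩) := by
  by_cases h : ∃ u, IsPred C k t u
  · obtain ⟨u, hu⟩ := h
    refine ⟨m.after ⟨(k, Int.fract u), hu.2.1⟩, fun u' hu' => ?_, fun hk => (hk _ hu.2.1).elim⟩
    obtain rfl := hu.unique hu'
    rfl
  · by_cases hk : ∀ t, (k, t) ∉ C
    · exact ⟨m.loop ⟨k, hk⟩, fun u hu => (h ⟨u, hu⟩).elim, fun _ => rfl⟩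
    -- The default value 0 plays no role for finite `C` with parameters in `[0, 1)`: by
    -- `exists_isPred_or` this case does not occur.
    · exact ⟨0, fun u hu => (h ⟨u, hu⟩).elim, fun h' => (hk h').elim⟩

/-- The label of each piece is spread over all its points: `L` reads it off at the last cut, and `R`
differs from `L` only at the cuts, where it takes the label of the arc that starts there. -/
theorem State.toLabelling_surjective {C : Set G.Place} (hC : C.Finite)
    (hI : ∀ p ∈ C, p.2 ∈ Ico (0 : ℝ) 1) :
    Function.Surjective (State.toLabelling : G.State C → G.Labelling C) := by
  classical
  intro m
  choose L hL hLloop using m.exists_value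
  set R : Fin G.numWires → ℝ → Fin 2 := fun k t =>
    if h : (k, Int.fract t) ∈ C then m.after ⟨_, h⟩ else L k t with hR
  have hRmem : ∀ k t (h : (k, Int.fract t) ∈ C), R k t = m.after ⟨_, h⟩ := fun k t h => dif_pos h
  have hRnot : ∀ k t, (k, Int.fract t) ∉ C → L k t = R k t := fun k t h => by
    simp only [hR, dif_neg h]
  have hcongr : ∀ k t t', (∀ u, IsPred C k t u → IsPred C k t' u) → L k t = L k t' := by
    intro k t t' h
    rcases exists_isPred_or hC hI k with hk | hk
    · obtain ⟨u, hu⟩ := hk t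
      rw [hL k t u hu, hL k t' u (h u hu)]
    · rw [hLloop k t hk, hLloop k t' hk]
  have hLper : ∀ k, Function.Periodic (L k) 1 := by
    intro k t
    rcases exists_isPred_or hC hI k with hk | hk
    · obtain ⟨u, hu⟩ := hk t
      have hu' : IsPred C k (t + 1) (u + 1) := by
        refine ⟨by linarith [hu.1], by simpa using hu.2.1, fun w hw => ?_⟩
        have := hu.2.2 (w - 1) ⟨by linarith [hw.1], by linarith [hw.2]⟩
        simpa using this
      rw [hL _ _ _ hu, hL _ _ _ hu']
      simp
    · rw [hLloop k _ hk, hLloop k _ hk]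
  have hRper : ∀ k, Function.Periodic (R k) 1 := by
    intro k t
    simp only [hR, hLper k t, Int.fract_add_one]
  have hstep : ∀ k, IsStep (L k) (R k) := by
    intro k t
    obtain ⟨a, b, hat, htb, hab⟩ := eventually_notMem hC k t
    refine ⟨?_, ?_⟩
    · filter_upwards [Ioo_mem_nhdsGT htb] with u hu
      have hLu : L k u = R k t := by
        -- If `t` is a cut, it is the last one before `u`; otherwise `t` and `u` have the same last
        -- cut.
        by_cases ht : (k, Int.fract t) ∈ C
        · rw [hRmem k t ht]
          exact hL k u t ⟨hu.1, ht, fun w hw =>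
            hab w ⟨hat.trans hw.1, hw.2.trans hu.2⟩ hw.1.ne'⟩
        · rw [← hRnot k t ht]
          refine (hcongr k t u fun w hw => ⟨hw.1.trans hu.1, hw.2.1, fun z hz => ?_⟩).symm
          rcases lt_trichotomy z t with h | h | h
          · exact hw.2.2 z ⟨hz.1, h⟩
          · rwa [h]
          · exact hab z ⟨hat.trans h, hz.2.trans hu.2⟩ h.ne'
      exact ⟨hLu, by rw [← hLu, hRnot k u (hab u ⟨hat.trans hu.1, hu.2⟩ hu.1.ne')]⟩
    · filter_upwards [Ioo_mem_nhdsLT hat] with u hu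
      have hLu : L k u = L k t := by
        refine (hcongr k t u fun w hw => ⟨?_, hw.2.1, fun z hz =>
          hw.2.2 z ⟨hz.1, hz.2.trans hu.2⟩⟩).symm
        by_contra h
        exact hab w ⟨hu.1.trans_le (not_lt.1 h), hw.1.trans htb⟩ hw.1.ne hw.2.1
      exact ⟨hLu, by rw [← hLu, hRnot k u (hab u ⟨hu.1, hu.2.trans htb⟩ hu.2.ne)]⟩
  refine ⟨⟨L, R, hLper, hRper, hstep, hRnot⟩, ?_⟩
  have hafter : ∀ c : C, R c.1.1 c.1.2 = m.after c := by
    rintro ⟨⟨k, t⟩, hc⟩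
    have ht := Int.fract_eq_self.2 (hI _ hc)
    simp only at ht ⊢
    rw [hRmem k t (by rwa [ht])]
    congr 3
  have hbefore : ∀ c : C, L c.1.1 c.1.2 = m.before c := by
    rintro ⟨⟨k, t⟩, hc⟩
    obtain ⟨u, hu⟩ := (exists_isPred_or hC hI k).resolve_right (fun h => h t hc) t
    rw [hL k t u hu]
    -- The predecessor `u` may lie in an earlier period; shifting by `⌊u⌋` moves it into `[0, 1)`,
    -- and `t` moves along with it.
    refine m.arc _ _ ⟨rfl, t - ⌊u⌋, ?_, ?_, ?_⟩
    · have := Int.self_sub_floor u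
      change Int.fract u < t - ⌊u⌋
      linarith [hu.1]
    · change Int.fract (t - ⌊u⌋) = t
      rw [Int.fract_sub_intCast]
      exact Int.fract_eq_self.2 (hI _ hc)
    · intro w hw
      have h0 := Int.self_sub_floor u
      have h1 : Int.fract u < w := hw.1
      have h2 : w < t - ⌊u⌋ := hw.2
      have := hu.2.2 (w + ⌊u⌋) ⟨by linarith, by linarith⟩
      rwa [Int.fract_add_intCast] at this
  cases m
  simp only [State.toLabelling, Labelling.mk.injEq]
  exact ⟨funext hbefore, funext hafter, funext fun k => hLloop k 0 k.2⟩

end WiringDiagram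

/-! Left and right limits of the integer part of a function that passes the integers with nonzero
derivative. -/

open Classical in
noncomputable def floorLeft (s : ℝ → ℝ) (t : ℝ) : ℤ :=
  if (∃ n : ℤ, s t = n) ∧ 0 < deriv s t then ⌊s t⌋ - 1 else ⌊s t⌋

open Classical in
noncomputable def floorRight (s : ℝ → ℝ) (t : ℝ) : ℤ :=
  if (∃ n : ℤ, s t = n) ∧ deriv s t < 0 then ⌊s t⌋ - 1 else ⌊s t⌋

theorem floorLeft_eq_floor {s : ℝ → ℝ} {t : ℝ} (h : ¬∃ n : ℤ, s t = n) :
    floorLeft s t = ⌊s t⌋ := if_neg fun h' => h h'.1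

theorem floorRight_eq_floor {s : ℝ → ℝ} {t : ℝ} (h : ¬∃ n : ℤ, s t = n) :
    floorRight s t = ⌊s t⌋ := if_neg fun h' => h h'.1

theorem floorLeft_floorRight_of_mem_Ioo {s : ℝ → ℝ} {t : ℝ} {n : ℤ} (h : (n : ℝ) < s t)
    (h' : s t < n + 1) : floorLeft s t = n ∧ floorRight s t = n := by
  have hn : ¬∃ m : ℤ, s t = m := by
    rintro ⟨m, hm⟩
    rw [hm] at h h'
    have h1 : n < m := by exact_mod_cast h
    have h2 : m < n + 1 := by exact_mod_cast h'
    omega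
  rw [floorLeft_eq_floor hn, floorRight_eq_floor hn, and_self, Int.floor_eq_iff]
  exact ⟨h.le, h'⟩

/-- The slope tends to the derivative, so slope times derivative tends to a positive square. This
fixes the side of `s t` on which `s u` lies, for `u` on either side of `t`. -/
theorem eventually_sign_of_deriv_ne_zero {s : ℝ → ℝ} {t : ℝ} (h : deriv s t ≠ 0) :
    ∀ᶠ u in 𝓝[≠] t, 0 < (s u - s t) * (u - t) * deriv s t := by
  have h1 := hasDerivAt_iff_tendsto_slope.1 (differentiableAt_of_deriv_ne_zero h).hasDerivAt
  have h2 := (h1.mul_const (deriv s t)).eventually_const_lt (mul_self_pos.2 h)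
  filter_upwards [h2, self_mem_nhdsWithin] with u hu hut
  have hne : u - t ≠ 0 := sub_ne_zero.2 hut
  have : (s u - s t) * (u - t) * deriv s t = slope s t u * deriv s t * (u - t) ^ 2 := by
    rw [slope_def_field]
    field_simp
  rw [this]
  positivity

/-- At an integer value the nonzero derivative forces a strict passage, so the integer part is
constant on each side nearby. At other values it is locally constant by continuity. -/
theorem isStep_floor {s : ℝ → ℝ} (hs : Continuous s)
    (h : ∀ t, (∃ n : ℤ, s t = n) → deriv s t ≠ 0) : IsStep (floorLeft s) (floorRight s) := by
  intro t
  by_cases ht : ∃ n : ℤ, s t = n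
  · have hd := h t ht
    have hsign := eventually_sign_of_deriv_ne_zero hd
    obtain ⟨n, hn⟩ := ht
    have hnear : ∀ᶠ u in 𝓝 t, s u ∈ Ioo ((n : ℝ) - 1) (n + 1) :=
      hs.continuousAt.eventually (Ioo_mem_nhds (by linarith) (by linarith))
    have hR := hsign.filter_mono (nhdsWithin_mono t (fun u (hu : t < u) => hu.ne'))
    have hL := hsign.filter_mono (nhdsWithin_mono t (fun u (hu : u < t) => hu.ne))
    have hfl : ⌊s t⌋ = n := by rw [hn, Int.floor_intCast]
    rcases lt_or_gt_of_ne hd with hneg | hpos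
    · have e1 : floorLeft s t = n := by
        rw [floorLeft, if_neg fun h' => absurd h'.2 hneg.not_gt, hfl]
      have e2 : floorRight s t = n - 1 := by rw [floorRight, if_pos ⟨⟨n, hn⟩, hneg⟩, hfl]
      rw [e1, e2]
      refine ⟨?_, ?_⟩
      · filter_upwards [hR, self_mem_nhdsWithin, nhdsWithin_le_nhds hnear] with u h1 h2 h3
        have h2' : 0 < u - t := sub_pos.2 h2
        have : s u < n := by
          by_contra hc
          have : 0 ≤ s u - s t := by rw [hn]; linarith
          nlinarith [mul_nonneg this h2'.le]
        exact floorLeft_floorRight_of_mem_Ioo (by push_cast; exact h3.1)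
          (by push_cast; linarith)
      · filter_upwards [hL, self_mem_nhdsWithin, nhdsWithin_le_nhds hnear] with u h1 h2 h3
        have h2' : 0 < t - u := sub_pos.2 h2
        have : n < s u := by
          by_contra hc
          have : 0 ≤ s t - s u := by rw [hn]; linarith
          nlinarith [mul_nonneg this h2'.le]
        exact floorLeft_floorRight_of_mem_Ioo this h3.2
    · have e1 : floorLeft s t = n - 1 := by rw [floorLeft, if_pos ⟨⟨n, hn⟩, hpos⟩, hfl]
      have e2 : floorRight s t = n := by
        rw [floorRight, if_neg fun h' => absurd h'.2 hpos.not_gt, hfl]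
      rw [e1, e2]
      refine ⟨?_, ?_⟩
      · filter_upwards [hR, self_mem_nhdsWithin, nhdsWithin_le_nhds hnear] with u h1 h2 h3
        have h2' : 0 < u - t := sub_pos.2 h2
        have : n < s u := by
          by_contra hc
          have : 0 ≤ s t - s u := by rw [hn]; linarith
          nlinarith [mul_nonneg this h2'.le]
        exact floorLeft_floorRight_of_mem_Ioo this h3.2
      · filter_upwards [hL, self_mem_nhdsWithin, nhdsWithin_le_nhds hnear] with u h1 h2 h3
        have h2' : 0 < t - u := sub_pos.2 h2
        have : s u < n := by
          by_contra hc
          have : 0 ≤ s u - s t := by rw [hn]; linarith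
          nlinarith [mul_nonneg this h2'.le]
        exact floorLeft_floorRight_of_mem_Ioo (by push_cast; exact h3.1)
          (by push_cast; linarith)
  · have e : ∀ᶠ u in 𝓝 t, floorLeft s u = ⌊s t⌋ ∧ floorRight s u = ⌊s t⌋ := by
      have h1 : (⌊s t⌋ : ℝ) < s t := lt_of_le_of_ne (Int.floor_le _) fun h' => ht ⟨_, h'.symm⟩
      filter_upwards [hs.continuousAt.eventually (Ioo_mem_nhds h1 (Int.lt_floor_add_one _))]
        with u hu
      exact floorLeft_floorRight_of_mem_Ioo hu.1 hu.2
    rw [floorLeft_eq_floor ht, floorRight_eq_floor ht]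
    exact ⟨nhdsWithin_le_nhds e, nhdsWithin_le_nhds e⟩

theorem floorLeft_add_one {s : ℝ → ℝ} {l : ℤ} (h : ∀ t, s (t + 1) = s t + l) (t : ℝ) :
    floorLeft s (t + 1) = floorLeft s t + l := by
  have hd : deriv s (t + 1) = deriv s t := by
    rw [← deriv_comp_add_const, funext h, deriv_add_const]
  have hi : (∃ n : ℤ, s t + l = n) ↔ ∃ n : ℤ, s t = n := by
    constructor
    · rintro ⟨n, hn⟩
      exact ⟨n - l, by push_cast; linarith⟩
    · rintro ⟨n, hn⟩
      exact ⟨n + l, by push_cast; linarith⟩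
  simp only [floorLeft]
  rw [h t, hd, Int.floor_add_intCast]
  by_cases hc : (∃ n : ℤ, s t = n) ∧ 0 < deriv s t
  · rw [if_pos hc, if_pos (by rwa [hi])]
    ring
  · rw [if_neg hc, if_neg (by rwa [hi])]

/-! ### Linear coordinates of a parallelogram -/

namespace Parallelogram

variable (P : Parallelogram)

theorem linCoord_add (v w : Fin 2 → ℝ) : P.linCoord (v + w) = P.linCoord v + P.linCoord w :=
  Matrix.add_vecMul _ _ _

theorem linCoord_sub (v w : Fin 2 → ℝ) : P.linCoord (v - w) = P.linCoord v - P.linCoord w :=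
  Matrix.sub_vecMul _ _ _

theorem linCoord_smul (c : ℝ) (v : Fin 2 → ℝ) : P.linCoord (c • v) = c • P.linCoord v :=
  Matrix.smul_vecMul _ _ _

theorem linCoord_sum {ι : Type*} (s : Finset ι) (v : ι → Fin 2 → ℝ) :
    P.linCoord (∑ i ∈ s, v i) = ∑ i ∈ s, P.linCoord (v i) :=
  Matrix.sum_vecMul _ _ _

theorem coord_eq (z : Fin 2 → ℝ) : P.coord z = P.linCoord z - P.linCoord P.corner :=
  P.linCoord_sub _ _

/-- The inverse of the basis matrix is again integral, as its determinant is 1. -/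
theorem exists_linCoord_latticeVec (l : Fin 2 → ℤ) (e : Fin 2) :
    ∃ n : ℤ, P.linCoord (latticeVec l) e = n := by
  refine ⟨(l ᵥ* (P.basis⁻¹).1) e, ?_⟩
  simp [linCoord, latticeVec, Matrix.vecMul, dotProduct]

theorem hasDerivAt_coord {c : ℝ → Fin 2 → ℝ} {c' : Fin 2 → ℝ} {t : ℝ} (h : HasDerivAt c c' t)
    (e : Fin 2) : HasDerivAt (fun t => P.coord (c t) e) (P.linCoord c' e) t := by
  have h' := hasDerivAt_pi.1 h
  simp only [coord_eq, Pi.sub_apply]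
  refine HasDerivAt.sub_const _ ?_
  simp only [linCoord, Matrix.vecMul, dotProduct, Fin.sum_univ_two]
  exact ((h' 0).mul_const _).add ((h' 1).mul_const _)

end Parallelogram

/-! ### Vertices, passages and the homology class of a state -/

namespace WiringDiagram

variable {G : WiringDiagram}

noncomputable instance fintypeVertex (G : WiringDiagram) : Fintype G.Vertex := Fintype.ofFinite _

theorem Vertex.exists_point_eq (v : G.Vertex) :
    ∃ l : Fin 2 → ℤ, G.point v.first = G.point v.second + latticeVec l := v.2.2.2.1

theorem exists_point_symm {p p' : G.Place}
    (h : ∃ l : Fin 2 → ℤ, G.point p = G.point p' + latticeVec l) :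
    ∃ l : Fin 2 → ℤ, G.point p' = G.point p + latticeVec l := by
  obtain ⟨l, hl⟩ := h
  refine ⟨-l, ?_⟩
  rw [hl]
  ext e
  simp [latticeVec]

theorem planeDet_self (v : Fin 2 → ℝ) : planeDet v v = 0 := by
  simp [planeDet, mul_comm]

theorem Vertex.first_ne_second (v : G.Vertex) : v.first ≠ v.second := by
  intro h
  have := v.2.2.2.2
  change 0 < planeDet (G.velocity v.first) (G.velocity v.second) at this
  rw [h, planeDet_self] at this
  exact lt_irrefl _ this

/-- Two vertices with a common first passage would put three passages at one point of the torus;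
only two are allowed, so their second passages coincide. -/
theorem Vertex.first_injective : Function.Injective (Vertex.first : G.Vertex → G.Place) := by
  intro v v' h
  have hv := v.exists_point_eq
  have hv' := v'.exists_point_eq
  rw [← h] at hv'
  refine Subtype.ext (Prod.ext h ?_)
  rcases G.double v.second v.first v'.second v.2.2.1 v.2.1 v'.2.2.1 (exists_point_symm hv) hv'
    with h1 | h1 | h1
  · exact (v.first_ne_second h1.symm).elim
  · exact (v'.first_ne_second (h ▸ h1)).elim
  · exact h1

theorem Vertex.second_injective : Function.Injective (Vertex.second : G.Vertex → G.Place) := by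
  intro v v' h
  have hv := v.exists_point_eq
  have hv' := v'.exists_point_eq
  rw [← h] at hv'
  refine Subtype.ext (Prod.ext ?_ h)
  rcases G.double v.first v.second v'.first v.2.1 v.2.2.1 v'.2.1 hv (exists_point_symm hv')
    with h1 | h1 | h1
  · exact (v.first_ne_second h1).elim
  · exact (v'.first_ne_second (h ▸ h1.symm)).elim
  · exact h1

/-- Otherwise both vertices would consist of the same two passages in opposite order, but the
determinant of the velocities changes sign under the exchange. -/
theorem Vertex.first_ne_second_of (v v' : G.Vertex) : v.first ≠ v'.second := by
  intro h
  have hv := v.exists_point_eq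
  have hv' := v'.exists_point_eq
  rw [← h] at hv'
  rcases G.double v.second v.first v'.first v.2.2.1 v.2.1 v'.2.1 (exists_point_symm hv)
    (exists_point_symm hv') with h1 | h1 | h1
  · exact v.first_ne_second h1.symm
  · exact v'.first_ne_second (h1 ▸ h)
  · have d : 0 < planeDet (G.velocity v.first) (G.velocity v.second) := v.2.2.2.2
    have d' : 0 < planeDet (G.velocity v'.first) (G.velocity v'.second) := v'.2.2.2.2
    rw [← h, ← h1] at d'
    simp only [planeDet] at d d'
    linarith

theorem finite_passages (G : WiringDiagram) : G.passages.Finite :=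
  (Set.finite_range _).union (Set.finite_range _)

theorem mem_Ico_of_mem_passages {p : G.Place} (hp : p ∈ G.passages) : p.2 ∈ Ico (0 : ℝ) 1 := by
  rcases hp with ⟨v, rfl⟩ | ⟨v, rfl⟩
  · exact v.2.1
  · exact v.2.2.1

/-- Every passage belongs to exactly one vertex, in exactly one of the two roles. -/
theorem sum_passages {M : Type*} [AddCommMonoid M] (f : G.Place → M) :
    ∑ p ∈ G.finite_passages.toFinset, f p = ∑ v : G.Vertex, (f v.first + f v.second) := by
  classical
  have : G.finite_passages.toFinset =
      Finset.univ.image Vertex.first ∪ Finset.univ.image Vertex.second := by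
    ext p
    simp [passages]
  rw [this, Finset.sum_union, Finset.sum_image Vertex.first_injective.injOn,
    Finset.sum_image Vertex.second_injective.injOn, Finset.sum_add_distrib]
  rw [Finset.disjoint_left]
  intro p hp hp'
  obtain ⟨v, -, rfl⟩ := Finset.mem_image.1 hp
  obtain ⟨v', -, h⟩ := Finset.mem_image.1 hp'
  exact v.first_ne_second_of v' h.symm

/-- The jump of a state at a place. -/
def State.jump {C : Set G.Place} (σ : G.State C) (p : G.Place) : ℤ :=
  ((σ.after p.1 p.2 : ℕ) : ℤ) - ((σ.before p.1 p.2 : ℕ) : ℤ)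

/-- At every vertex the number of outgoing labels `1` is that of incoming ones. -/
def State.Conserved {C : Set G.Place} (σ : G.State C) : Prop :=
  ∀ v : G.Vertex, σ.jump v.first + σ.jump v.second = 0

/-- The homology class of the cycle formed by the pieces with label `1`, obtained from the
displacement along the pieces by summation by parts. -/
noncomputable def State.homology {C : Set G.Place} (σ : G.State C) : Fin 2 → ℝ :=
  ∑ k, ((σ.before k 0 : ℕ) : ℝ) • (G.curve k 1 - G.curve k 0) -
    ∑ v : G.Vertex, ((σ.jump v.first : ℝ) • G.point v.first +
      (σ.jump v.second : ℝ) • G.point v.second)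

/-! ### Intersection numbers with the sides -/

namespace FundamentalDomain

variable (D : G.FundamentalDomain)

/-- The coordinate along a wire. -/
noncomputable def wireCoord (e : Fin 2) (k : Fin G.numWires) (t : ℝ) : ℝ :=
  D.coord (G.curve k t) e

theorem hasDerivAt_wireCoord (e : Fin 2) (k : Fin G.numWires) (t : ℝ) :
    HasDerivAt (D.wireCoord e k) (D.linCoord (G.velocity (k, t)) e) t :=
  D.hasDerivAt_coord (((G.contDiff k).differentiable one_ne_zero t).hasDerivAt) e

theorem exists_wireCoord_add_one (e : Fin 2) (k : Fin G.numWires) :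
    ∃ l : ℤ, ∀ t, D.wireCoord e k (t + 1) = D.wireCoord e k t + l := by
  obtain ⟨l, hl⟩ := G.closed k
  obtain ⟨n, hn⟩ := D.exists_linCoord_latticeVec l e
  refine ⟨n, fun t => ?_⟩
  rw [wireCoord, wireCoord, hl, Parallelogram.coord_eq, Parallelogram.coord_eq,
    Parallelogram.linCoord_add, Pi.sub_apply, Pi.add_apply, Pi.sub_apply, hn]
  ring

theorem wireCoord_fract {e : Fin 2} {k : Fin G.numWires} {l : ℤ}
    (h : ∀ t, D.wireCoord e k (t + 1) = D.wireCoord e k t + l) (t : ℝ) :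
    ∃ n : ℤ, D.wireCoord e k t = D.wireCoord e k (Int.fract t) + n := by
  have hper : Function.Periodic (fun t => D.wireCoord e k t - l * t) 1 := fun t => by
    simp only [h]; ring
  have h1 : D.wireCoord e k (Int.fract t) - l * Int.fract t = D.wireCoord e k t - l * t := by
    rw [Int.fract]; simpa using hper.sub_int_mul_eq ⌊t⌋ (x := t)
  refine ⟨l * ⌊t⌋, ?_⟩
  push_cast
  linear_combination -h1 + l * Int.self_sub_floor t

/-- Transversality is given only for parameters in `[0, 1)`; periodicity of the derivative carries
it to all others. -/
theorem deriv_wireCoord_ne_zero (e : Fin 2) (k : Fin G.numWires) (t : ℝ)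
    (ht : ∃ n : ℤ, D.wireCoord e k t = n) : deriv (D.wireCoord e k) t ≠ 0 := by
  obtain ⟨l, hl⟩ := D.exists_wireCoord_add_one e k
  obtain ⟨n, hn⟩ := ht
  obtain ⟨n', hn'⟩ := D.wireCoord_fract hl t
  have hper : Function.Periodic (deriv (D.wireCoord e k)) 1 := fun t => by
    rw [← deriv_comp_add_const, funext hl, deriv_add_const]
  have h1 : deriv (D.wireCoord e k) (Int.fract t) = deriv (D.wireCoord e k) t := by
    rw [Int.fract]; simpa using hper.sub_int_mul_eq ⌊t⌋ (x := t)
  rw [← h1, (D.hasDerivAt_wireCoord e k _).deriv]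
  refine D.cross e (k, Int.fract t) ⟨⟨Int.fract_nonneg t, Int.fract_lt_one t⟩, n - n', ?_⟩
  push_cast
  exact (by linarith : D.wireCoord e k (Int.fract t) = n - n')

theorem isStep_wireCoord (e : Fin 2) (k : Fin G.numWires) :
    IsStep (floorLeft (D.wireCoord e k)) (floorRight (D.wireCoord e k)) :=
  isStep_floor
    (continuous_iff_continuousAt.2 fun t => (D.hasDerivAt_wireCoord e k t).continuousAt)
    (D.deriv_wireCoord_ne_zero e k)

theorem floorRight_sub_floorLeft (e : Fin 2) {p : G.Place}
    (hp : p ∈ G.sidePlaces D.toParallelogram e) :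
    floorRight (D.wireCoord e p.1) p.2 - floorLeft (D.wireCoord e p.1) p.2 = D.sgn e p := by
  have hi : ∃ n : ℤ, D.wireCoord e p.1 p.2 = n := hp.2
  have hne := D.cross e p hp
  have hd := (D.hasDerivAt_wireCoord e p.1 p.2).deriv
  simp only [floorRight, floorLeft, hd, hi, true_and]
  change D.linCoord (G.velocity p) e ≠ 0 at hne
  rcases lt_or_gt_of_ne hne with h | h
  · rw [if_pos h, if_neg h.not_gt, sgn, if_neg (show ¬D.Outgoing e p from h.not_gt)]; ring
  · rw [if_neg h.not_gt, if_pos h, sgn, if_pos (show D.Outgoing e p from h)]; ring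

/-- The signed number of crossings of a state with a side is determined by its homology class. -/
theorem sum_side_eq (e : Fin 2) (σ : G.State G.passages) (hσ : σ.Conserved) :
    ((∑ p ∈ (D.finite_side e).toFinset, D.sgn e p * ((σ.after p.1 p.2 : ℕ) : ℤ) : ℤ) : ℝ) =
      D.linCoord σ.homology e := by
  classical
  -- Summation by parts: at a passage only the label jumps, since no vertex lies on the side; at a
  -- side only the integer part jumps, by the sign of the arrow.
  set L : Fin G.numWires → ℝ → ℤ := fun k t =>
    ((σ.before k t : ℕ) : ℤ) * floorLeft (D.wireCoord e k) t with hL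
  set R : Fin G.numWires → ℝ → ℤ := fun k t =>
    ((σ.after k t : ℕ) : ℤ) * floorRight (D.wireCoord e k) t with hR
  have hstep : ∀ k, IsStep (L k) (R k) := fun k =>
    (σ.step k).comp₂ (D.isStep_wireCoord e k) fun a n => ((a : ℕ) : ℤ) * n
  set F := G.finite_passages.toFinset ∪ (D.finite_side e).toFinset with hF
  have hnotside : ∀ p ∈ G.passages, ¬∃ n : ℤ, D.wireCoord e p.1 p.2 = n := fun p hp h =>
    D.vertex_notMem p hp e ⟨mem_Ico_of_mem_passages hp, h⟩
  have hincr : ∀ k, L k 1 - L k 0 = ∑ p ∈ F with p.1 = k, (R p.1 p.2 - L p.1 p.2) := by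
    intro k
    have hinj : Set.InjOn Prod.snd ((F.filter fun p => p.1 = k : Finset G.Place) : Set G.Place) := by
      intro p hp p' hp' h
      have h1 := (Finset.mem_filter.1 hp).2
      have h2 := (Finset.mem_filter.1 hp').2
      exact Prod.ext (h1.trans h2.symm) h
    rw [(hstep k).sub_eq_sum zero_le_one ((F.filter fun p => p.1 = k).image Prod.snd) ?_ ?_,
      Finset.sum_image hinj]
    · refine Finset.sum_congr rfl fun p hp => ?_
      rw [(Finset.mem_filter.1 hp).2]
    · intro t ht htJ
      have hnot : (k, t) ∉ F := fun h =>
        htJ (Finset.mem_image.2 ⟨(k, t), Finset.mem_filter.2 ⟨h, rfl⟩, rfl⟩)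
      simp only [hF, Finset.mem_union, Set.Finite.mem_toFinset, not_or] at hnot
      have h1 : ¬∃ n : ℤ, D.wireCoord e k t = n := fun h => hnot.2 ⟨ht, h⟩
      have h2 := σ.eq_of_notMem k t (by rw [Int.fract_eq_self.2 ht]; exact hnot.1)
      simp only [hL, hR, floorLeft_eq_floor h1, floorRight_eq_floor h1, h2]
    · intro t ht
      obtain ⟨p, hp, rfl⟩ := Finset.mem_image.1 ht
      have hp' := (Finset.mem_filter.1 hp).1
      simp only [hF, Finset.mem_union, Set.Finite.mem_toFinset] at hp'
      rcases hp' with h | h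
      · exact mem_Ico_of_mem_passages h
      · exact h.1
  have htotal : ∑ k, (L k 1 - L k 0) = ∑ v : G.Vertex,
      (σ.jump v.first * ⌊D.wireCoord e v.first.1 v.first.2⌋ +
        σ.jump v.second * ⌊D.wireCoord e v.second.1 v.second.2⌋) +
      ∑ p ∈ (D.finite_side e).toFinset, D.sgn e p * ((σ.after p.1 p.2 : ℕ) : ℤ) := by
    rw [Finset.sum_congr rfl fun k _ => hincr k, Finset.sum_fiberwise, hF, Finset.sum_union]
    · rw [← sum_passages fun p => σ.jump p * ⌊D.wireCoord e p.1 p.2⌋]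
      congr 1
      · refine Finset.sum_congr rfl fun p hp => ?_
        have hp' := hnotside p ((Set.Finite.mem_toFinset _).1 hp)
        simp only [hL, hR, floorLeft_eq_floor hp', floorRight_eq_floor hp', State.jump]
        ring
      · refine Finset.sum_congr rfl fun p hp => ?_
        have hp' := (Set.Finite.mem_toFinset _).1 hp
        have hnot : (p.1, Int.fract p.2) ∉ G.passages := by
          rw [Int.fract_eq_self.2 hp'.1]
          exact fun h => D.vertex_notMem p h e hp'
        simp only [hL, hR, σ.eq_of_notMem _ _ hnot, ← D.floorRight_sub_floorLeft e hp']
        ring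
    · rw [Finset.disjoint_left]
      intro p hp hp'
      exact D.vertex_notMem p ((Set.Finite.mem_toFinset _).1 hp) e
        ((Set.Finite.mem_toFinset _).1 hp')
  have hwire : ∀ k, ((L k 1 - L k 0 : ℤ) : ℝ) =
      ((σ.before k 0 : ℕ) : ℝ) * D.linCoord (G.curve k 1 - G.curve k 0) e := by
    intro k
    obtain ⟨l, hl⟩ := D.exists_wireCoord_add_one e k
    have h1 := hl 0
    have h2 := floorLeft_add_one hl 0
    have h3 := σ.before_periodic k 0
    rw [zero_add] at h1 h2 h3
    have h4 : D.linCoord (G.curve k 1 - G.curve k 0) e = l := by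
      simp only [wireCoord, Parallelogram.coord_eq, Pi.sub_apply] at h1
      rw [Parallelogram.linCoord_sub, Pi.sub_apply]
      linarith
    simp only [hL, h2, h3, h4]
    push_cast
    ring
  -- The integer parts at the two passages differ by the same integer as the linear coordinates. As
  -- the two label jumps cancel, only this difference matters, and integer parts may be replaced by
  -- linear coordinates.
  have hvertex : ∀ v : G.Vertex, ((σ.jump v.first * ⌊D.wireCoord e v.first.1 v.first.2⌋ +
        σ.jump v.second * ⌊D.wireCoord e v.second.1 v.second.2⌋ : ℤ) : ℝ) =
      D.linCoord ((σ.jump v.first : ℝ) • G.point v.first +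
        (σ.jump v.second : ℝ) • G.point v.second) e := by
    intro v
    obtain ⟨l, hl⟩ := v.exists_point_eq
    obtain ⟨n, hn⟩ := D.exists_linCoord_latticeVec l e
    have h1 : D.wireCoord e v.first.1 v.first.2 = D.wireCoord e v.second.1 v.second.2 + n := by
      change D.coord (G.point v.first) e = D.coord (G.point v.second) e + n
      rw [hl, Parallelogram.coord_eq, Parallelogram.coord_eq, Parallelogram.linCoord_add,
        Pi.sub_apply, Pi.add_apply, Pi.sub_apply, hn]
      ring
    have h2 : D.linCoord (G.point v.first) e = D.linCoord (G.point v.second) e + n := by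
      rw [hl, Parallelogram.linCoord_add, Pi.add_apply, hn]
    have h3 : (σ.jump v.first : ℝ) + σ.jump v.second = 0 := by exact_mod_cast hσ v
    rw [h1, Int.floor_add_intCast, Parallelogram.linCoord_add, Parallelogram.linCoord_smul,
      Parallelogram.linCoord_smul]
    simp only [Pi.add_apply, Pi.smul_apply, smul_eq_mul, h2]
    push_cast
    linear_combination
      ((⌊D.wireCoord e v.second.1 v.second.2⌋ : ℝ) - D.linCoord (G.point v.second) e) * h3
  have hreal := congrArg (Int.cast : ℤ → ℝ) htotal
  rw [Int.cast_add, Int.cast_sum, Int.cast_sum, Finset.sum_congr rfl fun k _ => hwire k,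
    Finset.sum_congr rfl fun v _ => hvertex v] at hreal
  rw [State.homology, Parallelogram.linCoord_sub, Parallelogram.linCoord_sum,
    Parallelogram.linCoord_sum, Pi.sub_apply, Finset.sum_apply, Finset.sum_apply]
  simp only [Parallelogram.linCoord_smul, Pi.smul_apply, smul_eq_mul]
  linarith

end FundamentalDomain

end WiringDiagram

/-! ### Conservation at the vertices and the transfer matrix as a state sum -/

theorem QWeyl.weight_eq_zero (q r s f g : ℂ) (a b i j : Fin 2)
    (h : (((a : ℕ) : ℤ) - ((i : ℕ) : ℤ)) + (((b : ℕ) : ℤ) - ((j : ℕ) : ℤ)) ≠ 0) :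
    QWeyl.weight q r s f g a b i j = 0 := by
  fin_cases a <;> fin_cases b <;> fin_cases i <;> fin_cases j <;>
    first | rfl | exact absurd (by norm_num) h

namespace WiringDiagram

variable {G : WiringDiagram}

/-- A state is also a state for a larger set of cuts. -/
def State.mono {C C' : Set G.Place} (h : C ⊆ C') (σ : G.State C) : G.State C' where
  __ := σ
  eq_of_notMem k t ht := σ.eq_of_notMem k t fun h' => ht (h h')

theorem State.mono_injective {C C' : Set G.Place} (h : C ⊆ C') :
    Function.Injective (State.mono h) := fun _ _ h' =>
  State.ext (congrArg (State.before (C := C')) h') (congrArg (State.after (C := C')) h')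

noncomputable instance fintypeState (G : WiringDiagram) : Fintype (G.State G.passages) :=
  haveI := G.finite_passages.to_subtype
  haveI := Finite.of_injective _ (State.toLabelling_injective G.finite_passages
    fun _ => mem_Ico_of_mem_passages)
  Fintype.ofFinite _

/-- The product of the weights of all vertices in a state. -/
noncomputable def State.vertexProduct {C : Set G.Place} (σ : G.State C) (q : ℂ)
    (r s f g : G.Vertex → ℂ) : G.WeylTensor q :=
  PiTensorProduct.tprod ℂ fun v : G.Vertex =>
    QWeyl.weight q (r v) (s v) (f v) (g v)
      (σ.after v.first.1 v.first.2) (σ.after v.second.1 v.second.2)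
      (σ.before v.first.1 v.first.2) (σ.before v.second.1 v.second.2)

/-- A single vanishing tensor factor kills the whole product. -/
theorem State.vertexProduct_eq_zero {C : Set G.Place} (σ : G.State C) (q : ℂ)
    (r s f g : G.Vertex → ℂ) (h : ¬σ.Conserved) : σ.vertexProduct q r s f g = 0 := by
  rw [State.Conserved, not_forall] at h
  obtain ⟨v, hv⟩ := h
  exact MultilinearMap.map_coord_zero _ v (QWeyl.weight_eq_zero _ _ _ _ _ _ _ _ _ hv)

namespace FundamentalDomain

variable (D : G.FundamentalDomain)

theorem mem_Ico_of_mem_cuts : ∀ p ∈ D.cuts, p.2 ∈ Ico (0 : ℝ) 1 := by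
  rintro p (hp | hp | hp)
  · exact mem_Ico_of_mem_passages hp
  · exact hp.1
  · exact hp.1

/-- The labels do not jump at the boundary of the domain. -/
def NoJump (m : G.Labelling D.cuts) : Prop :=
  (∀ c : D.East, m.before ⟨c, D.east_mem_cuts c⟩ = m.after ⟨c, D.east_mem_cuts c⟩) ∧
  (∀ c : D.North, m.before ⟨c, D.north_mem_cuts c⟩ = m.after ⟨c, D.north_mem_cuts c⟩)

/-- The labels after the places of the boundary. -/
def boundaryState (m : G.Labelling D.cuts) : D.BoundaryState :=
  (fun c => m.after ⟨c, D.east_mem_cuts c⟩, fun c => m.after ⟨c, D.north_mem_cuts c⟩)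

theorem far_near_iff (m : G.Labelling D.cuts) (e : Fin 2) (c : D.cuts) (a : Fin 2) :
    D.farLabel m e c = a ∧ D.nearLabel m e c = a ↔ a = m.after c ∧ m.before c = m.after c := by
  rw [farLabel, nearLabel]
  split_ifs
  · constructor
    · rintro ⟨h1, h2⟩
      exact ⟨h2.symm, h1.trans h2.symm⟩
    · rintro ⟨h1, h2⟩
      exact ⟨h2.trans h1.symm, h1.symm⟩
  · constructor
    · rintro ⟨h1, h2⟩
      exact ⟨h1.symm, h2.trans h1.symm⟩
    · rintro ⟨h1, h2⟩
      exact ⟨h1.symm, h2.trans h1.symm⟩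

theorem hasBoundary_diag_iff (m : G.Labelling D.cuts) (i : D.BoundaryState) :
    D.HasBoundary m i i ↔ i = D.boundaryState m ∧ D.NoJump m := by
  obtain ⟨i, j⟩ := i
  simp only [HasBoundary, far_near_iff, NoJump, boundaryState, Prod.mk.injEq, funext_iff,
    forall_and]
  tauto

/-- The labelling of the pieces given by a state which jumps only at vertices. -/
def labelling (σ : G.State G.passages) : G.Labelling D.cuts :=
  (σ.mono (show G.passages ⊆ D.cuts from subset_union_left)).toLabelling

theorem labelling_injective : Function.Injective D.labelling :=
  (State.toLabelling_injective (toFinite _) D.mem_Ico_of_mem_cuts).comp (State.mono_injective _)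

/-- A state for all the cuts of `D` that does not jump at the sides is already a state for the
vertices alone. -/
theorem range_labelling (m : G.Labelling D.cuts) :
    (∃ σ, D.labelling σ = m) ↔ D.NoJump m := by
  constructor
  · rintro ⟨σ, rfl⟩
    have h : ∀ e, ∀ p ∈ G.sidePlaces D.toParallelogram e,
        σ.before p.1 p.2 = σ.after p.1 p.2 := fun e p hp => by
      refine σ.eq_of_notMem _ _ ?_
      rw [Int.fract_eq_self.2 hp.1]
      exact fun h => D.vertex_notMem p h e hp
    exact ⟨fun c => h 0 c c.2, fun c => h 1 c c.2⟩
  · intro hm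
    obtain ⟨σ, rfl⟩ := State.toLabelling_surjective (toFinite _) D.mem_Ico_of_mem_cuts m
    refine ⟨⟨σ.before, σ.after, σ.before_periodic, σ.after_periodic, σ.step, fun k t ht => ?_⟩,
      rfl⟩
    rw [← σ.before_fract, ← σ.after_fract]
    by_cases h : (k, Int.fract t) ∈ D.cuts
    · rcases h with h | h | h
      · exact (ht h).elim
      · exact hm.1 ⟨_, h⟩
      · exact hm.2 ⟨_, h⟩
    · rw [σ.before_fract, σ.after_fract]
      exact σ.eq_of_notMem k t h

/-- The transfer matrix as a sum over states which jump only at the vertices. -/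
theorem transfer_eq_sum_state (q : ℂ) (r s f g : G.Vertex → ℂ) (x y : ℂˣ) :
    D.transfer q r s f g x y = ∑ σ : G.State G.passages,
      ((x ^ D.signedSum (D.boundaryState (D.labelling σ)) 0 *
        y ^ D.signedSum (D.boundaryState (D.labelling σ)) 1 : ℂˣ) : ℂ) •
          σ.vertexProduct q r s f g := by
  classical
  have h1 : D.transfer q r s f g x y = ∑ m : G.Labelling D.cuts with D.NoJump m,
      ((x ^ D.signedSum (D.boundaryState m) 0 * y ^ D.signedSum (D.boundaryState m) 1 : ℂˣ) : ℂ) •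
        D.vertexProduct q r s f g m := by
    simp only [transfer, Matrix.trace, Matrix.diag, monodromy, element, Finset.smul_sum,
      Finset.sum_filter]
    -- With the labelling fixed, at most one diagonal entry receives it: that of its own boundary
    -- state, and only if it does not jump at the boundary.
    rw [Finset.sum_comm]
    refine Finset.sum_congr rfl fun m _ => ?_
    by_cases hm : D.NoJump m
    · simp only [hasBoundary_diag_iff, hm, and_true, smul_ite, smul_zero]
      rw [Finset.sum_ite_eq' Finset.univ (D.boundaryState m), if_pos (Finset.mem_univ _),
        if_pos trivial]
    · simp [hasBoundary_diag_iff, hm]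
  have h2 : (Finset.univ.filter fun m : G.Labelling D.cuts => D.NoJump m) =
      Finset.univ.image D.labelling := by
    ext m
    simp [range_labelling]
  rw [h1, h2, Finset.sum_image D.labelling_injective.injOn]
  rfl

theorem signedSum_labelling (σ : G.State G.passages) (hσ : σ.Conserved) (e : Fin 2) :
    ((D.signedSum (D.boundaryState (D.labelling σ)) e : ℤ) : ℝ) = D.linCoord σ.homology e := by
  rw [← D.sum_side_eq e σ hσ]
  congr 1
  revert e
  rw [Fin.forall_fin_two]
  constructor
  · rw [Finset.sum_subtype (F := D.fintypeEast) (D.finite_side 0).toFinset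
      fun p => Set.Finite.mem_toFinset _]
    rfl
  · rw [Finset.sum_subtype (F := D.fintypeNorth) (D.finite_side 1).toFinset
      fun p => Set.Finite.mem_toFinset _]
    rfl

end FundamentalDomain

/-! ### Change of basis and of the spectral parameters -/

theorem linCoord_of_basis_eq {P P' : Parallelogram} {S : Matrix.SpecialLinearGroup (Fin 2) ℤ}
    (h : P'.basis = S * P.basis) (v : Fin 2 → ℝ) :
    P.linCoord v = P'.linCoord v ᵥ* S.1.map (Int.cast : ℤ → ℝ) := by
  have h1 : P.basis⁻¹ = P'.basis⁻¹ * S := by rw [h]; group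
  rw [Parallelogram.linCoord, Parallelogram.linCoord, Matrix.vecMul_vecMul, h1,
    Matrix.SpecialLinearGroup.coe_mul]
  congr 1
  exact Matrix.map_mul (f := Int.castRingHom ℝ)

theorem zpow_mul_zpow_of_eq {x y x' y' : ℂˣ} {S : Matrix.SpecialLinearGroup (Fin 2) ℤ}
    (hx : x' = x ^ S 0 0 * y ^ S 0 1) (hy : y' = x ^ S 1 0 * y ^ S 1 1) {n n' : Fin 2 → ℤ}
    (hn : n = n' ᵥ* S.1) : x' ^ n' 0 * y' ^ n' 1 = x ^ n 0 * y ^ n 1 := by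
  have h0 : n 0 = S 0 0 * n' 0 + S 1 0 * n' 1 := by
    rw [hn]; simp [Matrix.vecMul, dotProduct, Fin.sum_univ_two, mul_comm]
  have h1 : n 1 = S 0 1 * n' 0 + S 1 1 * n' 1 := by
    rw [hn]; simp [Matrix.vecMul, dotProduct, Fin.sum_univ_two, mul_comm]
  rw [h0, h1, hx, hy, mul_zpow, mul_zpow, zpow_add, zpow_add, zpow_mul, zpow_mul, zpow_mul,
    zpow_mul, mul_mul_mul_comm]

namespace FundamentalDomain

/-- The transfer matrix does not depend on the fundamental domain when the spectral parameters
are changed accordingly. -/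
theorem transfer_eq_transfer {D D' : G.FundamentalDomain}
    {S : Matrix.SpecialLinearGroup (Fin 2) ℤ} (h : D'.basis = S * D.basis) (q : ℂ)
    (r s f g : G.Vertex → ℂ) {x y x' y' : ℂˣ} (hx : x' = x ^ S 0 0 * y ^ S 0 1)
    (hy : y' = x ^ S 1 0 * y ^ S 1 1) :
    D'.transfer q r s f g x' y' = D.transfer q r s f g x y := by
  rw [transfer_eq_sum_state, transfer_eq_sum_state]
  refine Finset.sum_congr rfl fun σ _ => ?_
  -- The exponents need to match only for conserved states, where both pairs are coordinates of one
  -- homology class; all other states contribute zero on both sides.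
  by_cases hσ : σ.Conserved
  · congr 2
    refine zpow_mul_zpow_of_eq hx hy (funext fun e => ?_)
    have h1 := D.signedSum_labelling σ hσ e
    rw [linCoord_of_basis_eq h] at h1
    have h2 := D'.signedSum_labelling σ hσ
    simp only [Matrix.vecMul, dotProduct, Fin.sum_univ_two, ← h2, Matrix.map_apply] at h1 ⊢
    exact_mod_cast h1
  · rw [σ.vertexProduct_eq_zero q r s f g hσ, smul_zero, smul_zero]

end FundamentalDomain

end WiringDiagram

theorem proposition3p4 (G : WiringDiagram) (q : ℂ) (r s f g : G.Vertex → ℂ) :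
    (∀ (D D' : G.FundamentalDomain) (v : Fin 2 → ℝ),
      D'.corner = D.corner + v → D'.basis = D.basis →
      ∀ x y : ℂˣ, D'.transfer q r s f g x y = D.transfer q r s f g x y) ∧
    (∀ (D D' : G.FundamentalDomain) (S : Matrix.SpecialLinearGroup (Fin 2) ℤ),
      D'.basis = S * D.basis →
      ∀ x y x' y' : ℂˣ, x' = x ^ S 0 0 * y ^ S 0 1 → y' = x ^ S 1 0 * y ^ S 1 1 →
        D.transfer q r s f g x y = ∑ m : D.BoundaryState,
          ((x ^ D.signedSum m 0 * y ^ D.signedSum m 1 : ℂˣ) : ℂ) • D.element q r s f g m m ∧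
        D'.transfer q r s f g x' y' = (∑ m : D.BoundaryState,
          ((x' ^ (D.signedSum m ᵥ* (S⁻¹).1) 0 * y' ^ (D.signedSum m ᵥ* (S⁻¹).1) 1 : ℂˣ) : ℂ) •
            D.element q r s f g m m) ∧
        D'.transfer q r s f g x' y' = D.transfer q r s f g x y) := by
  refine ⟨fun D D' v _ h x y => ?_, fun D D' S h x y x' y' hx hy => ?_⟩
  -- A translation is the case of the identity matrix.
  · exact WiringDiagram.FundamentalDomain.transfer_eq_transfer (S := 1) (by rw [h, one_mul])
      q r s f g (by simp) (by simp)
  · have h1 := WiringDiagram.FundamentalDomain.transfer_eq_transfer h q r s f g hx hy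
    refine ⟨rfl, h1.trans (Finset.sum_congr rfl fun m _ => ?_), h1⟩
    -- For the middle formula the exponents need no topology: the substitution undoes the factor
    -- `S⁻¹` term by term in the sum for `D`.
    rw [WiringDiagram.zpow_mul_zpow_of_eq hx hy (n := D.signedSum m)]
    · rfl
    · rw [Matrix.vecMul_vecMul, ← Matrix.SpecialLinearGroup.coe_mul, inv_mul_cancel,
        Matrix.SpecialLinearGroup.coe_one, Matrix.vecMul_one]
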